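/- Let $\mathbb{U}$ be the open unit disc and let $H^2$ be the Hardy space of analytic functions $f(z)=\sum_{n\ge 0} a_n z^n$ on $\mathbb{U}$ with $\|f\|^2=\sum_{n\ge 0}|a_n|^2<\infty$. For a bounded analytic function $\varphi$ on $\mathbb{U}$ let $T_\varphi$ be the bounded operator $T_\varphi h=\varphi h$ on $H^2$, and let $\sigma_p(T_\varphi^*)$ be the set of eigenvalues of its adjoint. For bounded operators $A,B$ on $H^2$ write $A\propto B$ if $XA=BX$ for some nonzero bounded operator $X$ on $H^2$. A bounded analytic function on $\mathbb{U}$ is called inner if its radial limits exist and have modulus $1$ at almost every point of the unit circle. An analytic function $\varphi$ on $\mathbb{U}$ is called outer if $$\varphi(z)=c\,\exp\Big(\frac1{2\pi}\int_0^{2\pi}\frac{e^{i\theta}+z}{e^{i\theta}-z}\,\log w(e^{i\theta})\,d\theta\Big)\qquad(z\in\mathbb{U})$$ for some constant $c$ with $|c|=1$ and some positive function $w$ on the unit circle with $\log w$ integrable. Let $\varphi$ and $\psi$ be bounded analytic functions on $\mathbb{U}$. 1. If $\psi$ is a nonconstant inner function and $T_\varphi\propto T_\psi$, then $\mathbb{U}\subset\sigma_p(T_\varphi^*)$.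 2. If $\psi$ is an inner function (constant or not) and $T_\varphi\propto T_\psi$, then $\overline{\psi(z)}\in\sigma_p(T_\varphi^*)$ for every $z\in\mathbb{U}$. 3. If $\varphi$ is outer and $\psi$ is a nonconstant inner function, then $T_\varphi\not\propto T_\psi$. -/

import Mathlib

open Complex Metric Filter Topology
open scoped ENNReal ComplexConjugate InnerProductSpace

noncomputable section

namespace Hardy

/-- The Hardy space `H²` of the open unit disc: the power series `∑ aₙ zⁿ` with square-summable
coefficients, with the Hilbert space structure `⟪a, b⟫ = ∑ conj (aₙ) bₙ`.  An element is stored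
as its sequence of Taylor coefficients; `H2.eval` is the analytic function it represents. -/
abbrev H2 : Type := lp (fun _ : ℕ => ℂ) 2

/-- The value at `z` of the analytic function with Taylor coefficients `f`. -/
def H2.eval (f : H2) (z : ℂ) : ℂ := ∑' n, f n * z ^ n

/-- `φ` is a bounded analytic function on the open unit disc.
(Only the values of `φ` on the disc matter.) -/
def IsBoundedAnalytic (φ : ℂ → ℂ) : Prop :=
  DifferentiableOn ℂ φ (ball 0 1) ∧ ∃ M : ℝ, ∀ z ∈ ball (0 : ℂ) 1, ‖φ z‖ ≤ M

theorem H2.summable_norm (f : H2) {z : ℂ} (hz : z ∈ ball (0 : ℂ) 1) :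
    Summable (fun n => ‖f n * z ^ n‖) := by
  have hz' : ‖z‖ < 1 := by simpa using hz
  refine Summable.of_nonneg_of_le (fun _ => norm_nonneg _) (fun n => ?_)
    ((summable_geometric_of_lt_one (norm_nonneg z) hz').mul_left ‖f‖)
  rw [norm_mul, norm_pow]
  exact mul_le_mul_of_nonneg_right (lp.norm_apply_le_norm (by norm_num) f n) (by positivity)

theorem H2.eval_add (f g : H2) {z : ℂ} (hz : z ∈ ball (0 : ℂ) 1) :
    H2.eval (f + g) z = H2.eval f z + H2.eval g z := by
  unfold H2.eval
  rw [← (H2.summable_norm f hz).of_norm.tsum_add (H2.summable_norm g hz).of_norm]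
  simp [add_mul]

theorem H2.eval_smul (c : ℂ) (f : H2) (z : ℂ) : H2.eval (c • f) z = c * H2.eval f z := by
  unfold H2.eval
  rw [← tsum_mul_left]
  simp [mul_assoc]

theorem H2.norm_sq_eq (f : H2) : ‖f‖ ^ 2 = ∑' n, ‖f n‖ ^ 2 := by
  have h := lp.norm_rpow_eq_tsum (p := 2) (by norm_num) f
  simpa using h

theorem H2.summable_sq (f : H2) : Summable (fun n => ‖f n‖ ^ 2) := by
  have h := (lp.memℓp f).summable (p := 2) (by norm_num)
  simpa using h

section Parseval

/-- The boundary function `∑ αₙ e^{2πint}` of an absolutely summable sequence, in `L²`. -/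
def circleSeries (α : ℕ → ℂ) : C(AddCircle (1 : ℝ), ℂ) := ∑' n : ℕ, α n • fourier (n : ℤ)

theorem circleSeries_hasSum {α : ℕ → ℂ} (h : Summable fun n => ‖α n‖) :
    HasSum (fun n : ℕ => α n • (fourier (n : ℤ) : C(AddCircle (1 : ℝ), ℂ)))
      (circleSeries α) := by
  refine (Summable.of_norm ?_).hasSum
  simpa [norm_smul, fourier_norm] using h

theorem circleSeries_apply {α : ℕ → ℂ} (h : Summable fun n => ‖α n‖) (t : AddCircle (1 : ℝ)) :
    circleSeries α t = ∑' n, α n * (fourier 1 t : ℂ) ^ n := by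
  have := (circleSeries_hasSum h).mapL (ContinuousMap.evalCLM ℂ t)
  rw [← ContinuousMap.evalCLM_apply ℂ t, ← this.tsum_eq]
  congr 1
  ext n
  simp [fourier_apply, AddCircle.toCircle_nsmul]

theorem circleSeries_parseval {α : ℕ → ℂ} (h : Summable fun n => ‖α n‖) :
    HasSum (fun n => ‖α n‖ ^ 2)
      (‖ContinuousMap.toLp (E := ℂ) 2 AddCircle.haarAddCircle ℂ (circleSeries α)‖ ^ 2) := by
  set v := ContinuousMap.toLp (E := ℂ) 2 AddCircle.haarAddCircle ℂ (circleSeries α) with hv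
  have hs : HasSum (fun n : ℕ => α n • fourierLp (T := (1 : ℝ)) 2 (n : ℤ)) v := by
    have := (circleSeries_hasSum h).mapL
      (ContinuousMap.toLp (E := ℂ) 2 AddCircle.haarAddCircle ℂ)
    simpa [fourierLp] using this
  have ho : Orthonormal ℂ (fun n : ℕ => fourierLp (T := (1 : ℝ)) 2 (n : ℤ)) :=
    orthonormal_fourier.comp _ Nat.cast_injective
  have hin : ∀ n : ℕ, ⟪fourierLp (T := (1 : ℝ)) 2 (n : ℤ), v⟫_ℂ = α n := by
    intro n
    have h1 := hs.mapL (innerSL ℂ (fourierLp (T := (1 : ℝ)) 2 (n : ℤ)))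
    have h2 := hasSum_single (f := fun m : ℕ => innerSL ℂ (fourierLp (T := (1 : ℝ)) 2 (n : ℤ))
      (α m • fourierLp (T := (1 : ℝ)) 2 (m : ℤ))) n (by
        intro m hm
        simp only [innerSL_apply_apply, inner_smul_right]
        rw [ho.2 (i := n) (j := m) hm.symm, mul_zero])
    have h3 := h1.unique h2
    rw [innerSL_apply_apply] at h3
    rw [h3, innerSL_apply_apply, inner_smul_right, inner_self_eq_norm_sq_to_K, ho.1 n]
    simp
  have h4 := hs.mapL (innerSL ℂ v)
  have h5 : ∀ n : ℕ, innerSL ℂ v (α n • fourierLp (T := (1 : ℝ)) 2 (n : ℤ))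
      = ((‖α n‖ ^ 2 : ℝ) : ℂ) := by
    intro n
    rw [innerSL_apply_apply, inner_smul_right, ← inner_conj_symm, hin n, mul_conj,
      normSq_eq_norm_sq]
  simp only [h5] at h4
  rw [innerSL_apply_apply, inner_self_eq_norm_sq_to_K] at h4
  refine Complex.hasSum_ofReal.1 ?_
  simpa using h4

theorem parseval_le {α β : ℕ → ℂ} (hα : Summable fun n => ‖α n‖) (hβ : Summable fun n => ‖β n‖)
    {M : ℝ} (hle : ∀ z : ℂ, ‖z‖ = 1 → ‖∑' n, α n * z ^ n‖ ≤ M * ‖∑' n, β n * z ^ n‖) :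
    Summable (fun n => ‖α n‖ ^ 2) ∧ ∑' n, ‖α n‖ ^ 2 ≤ M ^ 2 * ∑' n, ‖β n‖ ^ 2 := by
  have h1 := circleSeries_parseval hα
  have h2 := circleSeries_parseval hβ
  refine ⟨h1.summable, ?_⟩
  rw [h1.tsum_eq, h2.tsum_eq, ← mul_pow]
  refine pow_le_pow_left₀ (norm_nonneg _) (MeasureTheory.Lp.norm_le_mul_norm_of_ae_le_mul ?_) 2
  filter_upwards [ContinuousMap.coeFn_toLp (E := ℂ) (p := 2) (𝕜 := ℂ) AddCircle.haarAddCircle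
      (circleSeries α), ContinuousMap.coeFn_toLp (E := ℂ) (p := 2) (𝕜 := ℂ)
      AddCircle.haarAddCircle (circleSeries β)] with t ha hb
  rw [ha, hb, circleSeries_apply hα, circleSeries_apply hβ]
  exact hle _ (by rw [fourier_apply]; exact Circle.norm_coe _)

end Parseval

/-- Two elements of `H²` that agree as functions on the disc are equal. -/
theorem H2.ext_eval {f g : H2} (h : ∀ z ∈ ball (0 : ℂ) 1, H2.eval f z = H2.eval g z) :
    f = g := by
  have hz : ∀ z ∈ ball (0 : ℂ) 1, H2.eval (f - g) z = 0 := by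
    intro z hz
    rw [sub_eq_add_neg, ← neg_one_smul ℂ g, H2.eval_add _ _ hz, H2.eval_smul, h z hz]
    ring
  rw [← sub_eq_zero]
  set d := f - g
  have hr : (1 / 2 : ℂ) ∈ ball (0 : ℂ) 1 := by simp; norm_num
  have hs := H2.summable_norm d hr
  have key := parseval_le (β := fun _ => 0) (M := 0) hs (by simp) (by
    intro z hz1
    have : ∑' n, d n * (1 / 2 : ℂ) ^ n * z ^ n = H2.eval d (1 / 2 * z) := by
      simp [H2.eval, mul_pow, mul_assoc]
    rw [this, hz]
    · simp
    · simp [hz1]; norm_num)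
  have h0 : ∑' n, ‖d n * (1 / 2 : ℂ) ^ n‖ ^ 2 = 0 :=
    le_antisymm (by simpa using key.2) (tsum_nonneg fun _ => by positivity)
  have h1 := (key.1.hasSum_iff.2 h0)
  rw [hasSum_zero_iff_of_nonneg (fun _ => by positivity)] at h1
  ext n
  have := congrFun h1 n
  simpa using this

theorem cauchy_product {b f c : ℕ → ℂ} {z : ℂ}
    (hc : ∀ n, c n = ∑ kl ∈ Finset.HasAntidiagonal.antidiagonal n, b kl.1 * f kl.2)
    (hb : Summable fun n => ‖b n * z ^ n‖) (hf : Summable fun n => ‖f n * z ^ n‖) :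
    (Summable fun n => ‖c n * z ^ n‖) ∧
      ∑' n, c n * z ^ n = (∑' n, b n * z ^ n) * ∑' n, f n * z ^ n := by
  have hcz : ∀ n, c n * z ^ n =
      ∑ kl ∈ Finset.HasAntidiagonal.antidiagonal n, (b kl.1 * z ^ kl.1) * (f kl.2 * z ^ kl.2) := by
    intro n
    rw [hc, Finset.sum_mul]
    refine Finset.sum_congr rfl fun kl hkl => ?_
    rw [← Finset.HasAntidiagonal.mem_antidiagonal.1 hkl, pow_add]
    ring
  simp only [hcz]
  exact ⟨summable_norm_sum_mul_antidiagonal_of_summable_norm (f := fun n => b n * z ^ n)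
      (g := fun n => f n * z ^ n) hb hf,
    (tsum_mul_tsum_eq_tsum_sum_antidiagonal_of_summable_norm (f := fun n => b n * z ^ n)
      (g := fun n => f n * z ^ n) hb hf).symm⟩

/-- If `φ` is bounded and analytic on the disc and `f ∈ H²` then `φ f ∈ H²`, and
`‖φ f‖ ≤ M ‖f‖` for any bound `M` of `|φ|`. -/
theorem exists_mul {φ : ℂ → ℂ} (hd : DifferentiableOn ℂ φ (ball 0 1)) {M : ℝ}
    (hM : ∀ z ∈ ball (0 : ℂ) 1, ‖φ z‖ ≤ M) (f : H2) :
    ∃ g : H2, (∀ z ∈ ball (0 : ℂ) 1, H2.eval g z = φ z * H2.eval f z) ∧ ‖g‖ ≤ M * ‖f‖ := by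
  have hM0 : 0 ≤ M := (norm_nonneg _).trans (hM 0 (by simp))
  set b : ℕ → ℂ := fun n => (n.factorial : ℂ)⁻¹ * iteratedDeriv n φ 0 with hb
  have hφ : ∀ z ∈ ball (0 : ℂ) 1, HasSum (fun n => b n * z ^ n) (φ z) := by
    intro z hz
    have e : (fun n => b n * z ^ n) = fun n : ℕ =>
        (n.factorial : ℂ)⁻¹ • (z - 0) ^ n • iteratedDeriv n φ 0 := by
      ext n
      simp only [hb, smul_eq_mul, sub_zero]
      ring
    rw [e]
    exact Complex.hasSum_taylorSeries_on_ball hd hz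
  set c : ℕ → ℂ := fun n => ∑ kl ∈ Finset.HasAntidiagonal.antidiagonal n, b kl.1 * f kl.2 with hc
  have hcp := fun z (hz : z ∈ ball (0 : ℂ) 1) => cauchy_product (z := z) (fun n => congrFun hc n)
    (summable_norm_iff.2 (hφ z hz).summable) (H2.summable_norm f hz)
  have hcs : ∀ z ∈ ball (0 : ℂ) 1, Summable (fun n => ‖c n * z ^ n‖) := fun z hz => (hcp z hz).1
  have hce : ∀ z ∈ ball (0 : ℂ) 1, ∑' n, c n * z ^ n = φ z * H2.eval f z := by
    intro z hz
    rw [(hcp z hz).2, (hφ z hz).tsum_eq, H2.eval]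
  clear_value c
  have hfin : ∀ r : ℝ, r ∈ Set.Ioo (0 : ℝ) 1 → ∀ s : Finset ℕ,
      ∑ n ∈ s, ‖c n * (r : ℂ) ^ n‖ ^ 2 ≤ M ^ 2 * ‖f‖ ^ 2 := by
    intro r hr s
    have hrb : (r : ℂ) ∈ ball (0 : ℂ) 1 := by simp [abs_of_pos hr.1, hr.2]
    have key := parseval_le (M := M) (hcs r hrb) (H2.summable_norm f hrb) (by
      intro z hz
      have hzr : (r : ℂ) * z ∈ ball (0 : ℂ) 1 := by simp [hz, abs_of_pos hr.1, hr.2]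
      have e1 : ∑' n, c n * (r : ℂ) ^ n * z ^ n = φ (r * z) * H2.eval f (r * z) := by
        rw [← hce _ hzr]; simp [mul_pow, mul_assoc]
      have e2 : ∑' n, f n * (r : ℂ) ^ n * z ^ n = H2.eval f (r * z) := by
        simp [H2.eval, mul_pow, mul_assoc]
      rw [e1, e2, norm_mul]
      exact mul_le_mul_of_nonneg_right (hM _ hzr) (norm_nonneg _))
    refine (key.1.sum_le_tsum s fun _ _ => by positivity).trans (key.2.trans ?_)
    refine mul_le_mul_of_nonneg_left ?_ (by positivity)
    rw [H2.norm_sq_eq]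
    have hterm : ∀ n, ‖f n * (r : ℂ) ^ n‖ ^ 2 ≤ ‖f n‖ ^ 2 := by
      intro n
      refine pow_le_pow_left₀ (norm_nonneg _) ?_ 2
      rw [norm_mul, norm_pow]
      refine mul_le_of_le_one_right (norm_nonneg _) (pow_le_one₀ (norm_nonneg _) ?_)
      simp [abs_of_pos hr.1, hr.2.le]
    exact Summable.tsum_le_tsum hterm
      ((H2.summable_sq f).of_nonneg_of_le (fun _ => by positivity) hterm) (H2.summable_sq f)
  have hfin1 : ∀ s : Finset ℕ, ∑ n ∈ s, ‖c n‖ ^ 2 ≤ M ^ 2 * ‖f‖ ^ 2 := by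
    intro s
    have hcont : Continuous (fun r : ℝ => ∑ n ∈ s, ‖c n * (r : ℂ) ^ n‖ ^ 2) := by fun_prop
    have ht : Tendsto (fun r : ℝ => ∑ n ∈ s, ‖c n * (r : ℂ) ^ n‖ ^ 2) (𝓝[<] 1)
        (𝓝 (∑ n ∈ s, ‖c n‖ ^ 2)) := by
      have := (hcont.tendsto 1).mono_left (nhdsWithin_le_nhds (s := Set.Iio 1))
      simpa using this
    refine le_of_tendsto ht ?_
    filter_upwards [Ioo_mem_nhdsLT (show (0 : ℝ) < 1 by norm_num)] with r hr using hfin r hr s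
  have hmem : Memℓp c 2 := by
    refine memℓp_gen' (C := M ^ 2 * ‖f‖ ^ 2) fun s => ?_
    simpa using hfin1 s
  refine ⟨⟨c, hmem⟩, fun z hz => hce z hz, ?_⟩
  refine lp.norm_le_of_forall_sum_le (by norm_num) (by positivity) fun s => ?_
  simpa [mul_pow] using hfin1 s

theorem exists_toeplitz {φ : ℂ → ℂ} (hφ : IsBoundedAnalytic φ) :
    ∃ T : H2 →L[ℂ] H2, ∀ f : H2, ∀ z ∈ ball (0 : ℂ) 1,
      H2.eval (T f) z = φ z * H2.eval f z := by
  obtain ⟨hd, M, hM⟩ := hφ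
  choose T hT hn using exists_mul hd hM
  refine ⟨LinearMap.mkContinuous ⟨⟨T, fun f g => ?_⟩, fun a f => ?_⟩ M hn, hT⟩
  · refine H2.ext_eval fun z hz => ?_
    rw [hT _ z hz, H2.eval_add _ _ hz, H2.eval_add _ _ hz, hT _ z hz, hT _ z hz, mul_add]
  · refine H2.ext_eval fun z hz => ?_
    simp only [RingHom.id_apply]
    rw [hT _ z hz, H2.eval_smul, H2.eval_smul, hT _ z hz, mul_left_comm]

/-- The analytic Toeplitz operator `T_φ h = φ h` on `H²`, for `φ` bounded and analytic on the
disc: the bounded operator that acts as pointwise multiplication by `φ`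
(see `toeplitz_eval`; it is unique by `toeplitz_unique`). -/
def toeplitz (φ : ℂ → ℂ) (hφ : IsBoundedAnalytic φ) : H2 →L[ℂ] H2 :=
  (exists_toeplitz hφ).choose

theorem toeplitz_eval {φ : ℂ → ℂ} (hφ : IsBoundedAnalytic φ) (f : H2) {z : ℂ}
    (hz : z ∈ ball (0 : ℂ) 1) : H2.eval (toeplitz φ hφ f) z = φ z * H2.eval f z :=
  (exists_toeplitz hφ).choose_spec f z hz

theorem toeplitz_unique {φ : ℂ → ℂ} (hφ : IsBoundedAnalytic φ) {T : H2 →L[ℂ] H2}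
    (hT : ∀ f : H2, ∀ z ∈ ball (0 : ℂ) 1, H2.eval (T f) z = φ z * H2.eval f z) :
    T = toeplitz φ hφ :=
  ContinuousLinearMap.ext fun f => H2.ext_eval fun z hz => by
    rw [hT f z hz, toeplitz_eval hφ f hz]

/-- `A ∝ B`: some nonzero bounded operator `X` satisfies `X A = B X`. -/
def Intertwined (A B : H2 →L[ℂ] H2) : Prop :=
  ∃ X : H2 →L[ℂ] H2, X ≠ 0 ∧ X ∘L A = B ∘L X

/-- The point spectrum of a bounded operator: its set of eigenvalues. -/
def pointSpectrum (A : H2 →L[ℂ] H2) : Set ℂ :=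
  {l | Module.End.HasEigenvalue (A : H2 →ₗ[ℂ] H2) l}

/-- `ψ` is constant on the open unit disc. -/
def IsConstantOnDisc (ψ : ℂ → ℂ) : Prop := ∃ c : ℂ, ∀ z ∈ ball (0 : ℂ) 1, ψ z = c

/-- Inner function: a bounded analytic function on the disc whose radial limits exist and have
modulus one at almost every point `e^{iθ}` of the unit circle. -/
def IsInner (ψ : ℂ → ℂ) : Prop :=
  IsBoundedAnalytic ψ ∧
    ∀ᵐ θ : ℝ, ∃ w : ℂ, ‖w‖ = 1 ∧
      Tendsto (fun r : ℝ => ψ (r * exp (θ * I))) (𝓝[<] 1) (𝓝 w)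

/-- Outer function: `φ(z) = c exp( (1/2π) ∫ (e^{iθ} + z)/(e^{iθ} - z) log w(e^{iθ}) dθ )` on the
disc, where `|c| = 1` and `w` is a positive function on the circle with `log w` integrable. -/
def IsOuter (φ : ℂ → ℂ) : Prop :=
  ∃ (c : ℂ) (w : ℂ → ℝ), ‖c‖ = 1 ∧ (∀ ζ ∈ sphere (0 : ℂ) 1, 0 < w ζ) ∧
    CircleIntegrable (fun ζ => Real.log (w ζ)) 0 1 ∧
    ∀ z ∈ ball (0 : ℂ) 1,
      φ z = c * exp (Real.circleAverage
        (fun ζ => (ζ + z) / (ζ - z) * (Real.log (w ζ) : ℂ)) 0 1)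

end Hardy

end

/-!
Write `V = T_ψ` and let `X T_φ = V X`.

The operator `V` is an isometry when `ψ` is inner (`IsInner.norm_toeplitz`): `2π ‖g‖²` is the limit,
as `r → 1`, of the integral of `|g|²` over the circle of radius `r`, and for `g = ψ p` with `p` a
polynomial this limit is `∫ |p|²` over the unit circle by dominated convergence, whatever `ψ` is;
polynomials are dense in `H²`.

Let `|λ| < 1` and suppose that `λ` is not an eigenvalue of `T_φ^*`.  Since `T_φ^* X^* = X^* V^*`, the
operator `X^*` maps eigenvectors of `V^*` for `λ` to eigenvectors of `T_φ^*` or to zero, hence it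
kills `ker (V^* - λ)`.  The range of `V - conj λ` is closed, as `V` is isometric, so the range of
`X` lies in it, and `X = (V - conj λ) Y` for a bounded `Y` which again satisfies `Y T_φ = V Y`.
Iterating, `X = (V - conj λ)ⁿ Yₙ` for all `n`
(`ContinuousLinearMap.exists_eq_pow_sub_conj_smul_comp`).  Now
`‖(V - conj λ)ⁿ h‖ = ‖(1 - λ V)ⁿ h‖` for an isometry, so an element `f` of the range of every
`(V - conj λ)ⁿ` is `bⁿ gₙ`, where `b = (ψ - conj λ) / (1 - λ ψ)` and `‖gₙ‖ = ‖f‖`.  If `ψ` is not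
constant, then `|ψ| < 1` and `|b| < 1` in the disc, point evaluations are bounded, and `f = 0`
(`IsInner.eq_zero_of_forall_exists_pow`).  Thus `X = 0`.  This gives the first claim, and the
second, as `|ψ| < 1` unless `ψ` is constant; for `ψ = c` constant, `T_φ^* X^* = conj c X^*`.

For the third claim `0` would be an eigenvalue of `T_φ^*`.  But if `φ` is the outer function of
modulus `w`, the Herglotz integrals of `min (-log w, n)` give bounded analytic `hₙ` with
`|φ hₙ| ≤ 1` and `φ hₙ → 1` pointwise in the disc (`IsOuter.exists_approximate_inverse`).  The
contractions `T_{φ hₙ}^* = T_{hₙ}^* T_φ^*` converge to the identity on the reproducing kernels, whose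
span is dense, so `T_φ^*` is injective (`IsOuter.eq_zero_of_adjoint_toeplitz_eq_zero`).
-/

/-! ### Reproducing kernels and the isometry given by an inner function -/

namespace Hardy

/-- The kernel at `z` has the Taylor coefficients `conj z ^ n`. -/
theorem H2.exists_reproducing_kernel {z : ℂ} (hz : z ∈ ball (0 : ℂ) 1) :
    ∃ k : H2, ∀ f : H2, ⟪k, f⟫_ℂ = H2.eval f z := by
  have hz' : ‖z‖ < 1 := by simpa using hz
  have hk : Memℓp (fun n : ℕ => conj z ^ n) 2 := by
    refine memℓp_gen ?_
    have := summable_geometric_of_lt_one (r := ‖z‖ ^ 2) (by positivity)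
      (pow_lt_one₀ (norm_nonneg z) hz' two_ne_zero)
    refine this.congr fun n => ?_
    simp [← pow_mul, mul_comm]
  refine ⟨⟨fun n => conj z ^ n, hk⟩, fun f => ?_⟩
  rw [lp.inner_eq_tsum, H2.eval]
  refine tsum_congr fun n => ?_
  simp [RCLike.inner_apply]

theorem H2.exists_norm_eval_le {z : ℂ} (hz : z ∈ ball (0 : ℂ) 1) :
    ∃ C : ℝ, 0 ≤ C ∧ ∀ f : H2, ‖H2.eval f z‖ ≤ C * ‖f‖ := by
  obtain ⟨k, hk⟩ := H2.exists_reproducing_kernel hz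
  exact ⟨‖k‖, norm_nonneg k, fun f => hk f ▸ norm_inner_le_norm k f⟩

/-- Parseval's identity on the circle of radius `r`. -/
theorem H2.integral_norm_sq_eval (f : H2) {r : ℝ} (hr : r ∈ Set.Ioo (0 : ℝ) 1) :
    ∫ θ in (0 : ℝ)..2 * Real.pi, ‖H2.eval f (r * exp (θ * I))‖ ^ 2
      = 2 * Real.pi * ∑' n, ‖f n * (r : ℂ) ^ n‖ ^ 2 := by
  have hrb : (r : ℂ) ∈ ball (0 : ℂ) 1 := by simp [abs_of_pos hr.1, hr.2]
  have hs := H2.summable_norm f hrb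
  set S := circleSeries fun n => f n * (r : ℂ) ^ n with hS
  have hval : ∀ t : ℝ, S (t : AddCircle (1 : ℝ))
      = H2.eval f (r * exp ((2 * Real.pi * t : ℝ) * I)) := by
    intro t
    rw [hS, circleSeries_apply hs, H2.eval]
    refine tsum_congr fun n => ?_
    rw [mul_pow, mul_assoc, fourier_coe_apply]
    congr 4
    push_cast
    ring
  have hnorm : ‖ContinuousMap.toLp (E := ℂ) 2 AddCircle.haarAddCircle ℂ S‖ ^ 2
      = ∫ t in (0 : ℝ)..1, ‖S (t : AddCircle (1 : ℝ))‖ ^ 2 := by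
    have h1 := AddCircle.intervalIntegral_preimage (1 : ℝ) 0 (fun t => ‖S t‖ ^ 2)
    rw [AddCircle.volume_eq_smul_haarAddCircle] at h1
    simp only [zero_add, ENNReal.ofReal_one, one_smul] at h1
    rw [h1]
    have h2 := MeasureTheory.ContinuousMap.inner_toLp (𝕜 := ℂ)
      (AddCircle.haarAddCircle (T := (1 : ℝ))) S S
    rw [inner_self_eq_norm_sq_to_K] at h2
    simp only [mul_conj, normSq_eq_norm_sq] at h2
    rw [integral_complex_ofReal] at h2
    refine Complex.ofReal_injective ?_
    rw [Complex.ofReal_pow]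
    exact h2
  rw [(circleSeries_parseval hs).tsum_eq, hnorm]
  simp only [hval]
  have := intervalIntegral.integral_comp_mul_left (a := 0) (b := 1) (c := 2 * Real.pi)
    (fun θ : ℝ => ‖H2.eval f (r * exp (θ * I))‖ ^ 2) (by positivity)
  rw [this, smul_eq_mul, mul_inv_cancel_left₀ (by positivity)]
  simp

theorem H2.tendsto_integral_norm_sq_eval (f : H2) :
    Tendsto (fun r : ℝ => ∫ θ in (0 : ℝ)..2 * Real.pi, ‖H2.eval f (r * exp (θ * I))‖ ^ 2)
      (𝓝[<] 1) (𝓝 (2 * Real.pi * ‖f‖ ^ 2)) := by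
  have hev : ∀ᶠ r : ℝ in 𝓝[<] 1, r ∈ Set.Ioo (0 : ℝ) 1 :=
    Ioo_mem_nhdsLT (show (0 : ℝ) < 1 by norm_num)
  have : Tendsto (fun r : ℝ => 2 * Real.pi * ∑' n, ‖f n * (r : ℂ) ^ n‖ ^ 2)
      (𝓝[<] 1) (𝓝 (2 * Real.pi * ‖f‖ ^ 2)) := by
    refine Tendsto.const_mul _ ?_
    rw [H2.norm_sq_eq]
    refine tendsto_tsum_of_dominated_convergence (H2.summable_sq f) (fun n => ?_) ?_
    · have hc : Continuous fun r : ℝ => ‖f n * (r : ℂ) ^ n‖ ^ 2 := by fun_prop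
      have := (hc.tendsto 1).mono_left (nhdsWithin_le_nhds (s := Set.Iio 1))
      simpa using this
    · filter_upwards [hev] with r hr n
      rw [Real.norm_of_nonneg (by positivity)]
      refine pow_le_pow_left₀ (norm_nonneg _) ?_ 2
      rw [norm_mul, norm_pow]
      refine mul_le_of_le_one_right (norm_nonneg _) (pow_le_one₀ (norm_nonneg _) ?_)
      simp [abs_of_pos hr.1, hr.2.le]
  refine this.congr' ?_
  filter_upwards [hev] with r hr using (H2.integral_norm_sq_eval f hr).symm

/-- The norm of `g = ψ p` depends only on the boundary values of `p`: the integrals of `|ψ p|²` over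
the circles of radius `r` converge to that of `|p|²` over the unit circle. -/
theorem IsInner.norm_of_eval_eq_mul {ψ : ℂ → ℂ} (hψ : IsInner ψ) {p : ℂ → ℂ}
    (hp : Continuous p) {g : H2} (hg : ∀ z ∈ ball (0 : ℂ) 1, H2.eval g z = ψ z * p z) :
    2 * Real.pi * ‖g‖ ^ 2 = ∫ θ in (0 : ℝ)..2 * Real.pi, ‖p (exp (θ * I))‖ ^ 2 := by
  obtain ⟨⟨hd, M, hM⟩, hlim⟩ := hψ
  have hev : ∀ᶠ r : ℝ in 𝓝[<] 1, r ∈ Set.Ioo (0 : ℝ) 1 :=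
    Ioo_mem_nhdsLT (show (0 : ℝ) < 1 by norm_num)
  have hmem : ∀ r ∈ Set.Ioo (0 : ℝ) 1, ∀ θ : ℝ, (r : ℂ) * exp (θ * I) ∈ ball (0 : ℂ) 1 := by
    intro r hr θ
    simp [norm_exp_ofReal_mul_I, abs_of_pos hr.1, hr.2]
  obtain ⟨B, hB⟩ := (isCompact_closedBall (0 : ℂ) 1).exists_bound_of_continuousOn hp.continuousOn
  refine tendsto_nhds_unique (H2.tendsto_integral_norm_sq_eval g) ?_
  refine intervalIntegral.tendsto_integral_filter_of_dominated_convergence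
    (fun _ => (M * B) ^ 2) ?_ ?_ intervalIntegrable_const ?_
  · filter_upwards [hev] with r hr
    refine Continuous.aestronglyMeasurable ?_
    simp only [hg _ (hmem r hr _)]
    have h1 : Continuous fun θ : ℝ => ψ (r * exp (θ * I)) :=
      hd.continuousOn.comp_continuous (by fun_prop) (hmem r hr)
    have h2 : Continuous fun θ : ℝ => p (r * exp (θ * I)) := by fun_prop
    exact (h1.mul h2).norm.pow 2
  · filter_upwards [hev] with r hr
    refine Eventually.of_forall fun θ _ => ?_
    rw [hg _ (hmem r hr θ), Real.norm_of_nonneg (by positivity), norm_mul]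
    have hM0 : 0 ≤ M := (norm_nonneg _).trans (hM 0 (by simp))
    gcongr
    · exact hM _ (hmem r hr θ)
    · exact hB _ (ball_subset_closedBall (hmem r hr θ))
  · filter_upwards [hlim] with θ hθ _
    obtain ⟨w, hw, ht⟩ := hθ
    have h1 : Tendsto (fun r : ℝ => p (r * exp (θ * I))) (𝓝[<] 1) (𝓝 (p (exp (θ * I)))) := by
      have hc : Continuous fun r : ℝ => p (r * exp (θ * I)) := by fun_prop
      simpa using (hc.tendsto 1).mono_left (nhdsWithin_le_nhds (s := Set.Iio 1))
    have h2 := ((ht.mul h1).norm).pow 2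
    rw [norm_mul, hw, one_mul] at h2
    refine h2.congr' ?_
    filter_upwards [hev] with r hr
    rw [hg _ (hmem r hr θ)]

theorem isInner_one : IsInner fun _ => 1 := by
  refine ⟨⟨differentiableOn_const 1, 1, fun z _ => by simp⟩, Eventually.of_forall fun θ => ?_⟩
  exact ⟨1, by simp, tendsto_const_nhds⟩

/-- Multiplication by an inner function is an isometry of `H²`. -/
theorem IsInner.norm_toeplitz {ψ : ℂ → ℂ} (hψ : IsInner ψ) (hb : IsBoundedAnalytic ψ) (f : H2) :
    ‖toeplitz ψ hb f‖ = ‖f‖ := by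
  have hfin : ∀ s : Finset ℕ, ∀ f : H2,
      ‖toeplitz ψ hb (∑ n ∈ s, lp.single 2 n (f n))‖ = ‖∑ n ∈ s, lp.single 2 n (f n)‖ := by
    intro s f
    set F : H2 := ∑ n ∈ s, lp.single 2 n (f n) with hF
    have hFn : ∀ n, F n = if n ∈ s then f n else 0 := by
      intro n
      rw [hF, lp.coeFn_sum, Finset.sum_apply]
      simp [lp.single_apply, Pi.single_apply]
    have hFe : ∀ z, H2.eval F z = ∑ n ∈ s, f n * z ^ n := by
      intro z
      rw [H2.eval, tsum_eq_sum (s := s) fun n hn => by simp [hFn, hn]]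
      exact Finset.sum_congr rfl fun n hn => by simp [hFn, hn]
    have hc : Continuous fun z : ℂ => ∑ n ∈ s, f n * z ^ n := by fun_prop
    -- Compare with the constant inner function `1`: both norms are the same boundary integral.
    have h1 := hψ.norm_of_eval_eq_mul hc (g := toeplitz ψ hb F) fun z hz => by
      rw [toeplitz_eval hb F hz, hFe]
    have h2 := isInner_one.norm_of_eval_eq_mul hc (g := F) fun z _ => by rw [hFe, one_mul]
    rw [← h2] at h1
    exact (pow_left_inj₀ (norm_nonneg _) (norm_nonneg _) two_ne_zero).1
      (mul_left_cancel₀ (by positivity) h1)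
  have hs := lp.hasSum_single (E := fun _ : ℕ => ℂ) (p := 2) (by norm_num) f
  have h1 := ((toeplitz ψ hb).continuous.norm.tendsto f).comp hs
  have h2 := (continuous_norm.tendsto f).comp hs
  refine tendsto_nhds_unique h1 (h2.congr fun s => ?_)
  exact (hfin s f).symm

theorem IsInner.norm_le_one {ψ : ℂ → ℂ} (hψ : IsInner ψ) {z : ℂ} (hz : z ∈ ball (0 : ℂ) 1) :
    ‖ψ z‖ ≤ 1 := by
  obtain ⟨k, hk⟩ := H2.exists_reproducing_kernel hz
  have hk0 : k ≠ 0 := by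
    rintro rfl
    have := hk (lp.single 2 0 1)
    rw [inner_zero_left, H2.eval, tsum_eq_single 0 fun n hn => by
      simp [lp.single_apply, hn]] at this
    simp [lp.single_apply] at this
  -- `conj (ψ z)` is an eigenvalue of the adjoint of an isometry, with eigenvector `k`.
  have h := toeplitz_eval hψ.1 k hz
  rw [← hk, ← hk] at h
  have h1 : ‖ψ z‖ * ‖k‖ ^ 2 ≤ 1 * ‖k‖ ^ 2 := by
    calc ‖ψ z‖ * ‖k‖ ^ 2 = ‖⟪k, toeplitz ψ hψ.1 k⟫_ℂ‖ := by
          rw [h, norm_mul, inner_self_eq_norm_sq_to_K]; simp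
      _ ≤ ‖k‖ * ‖toeplitz ψ hψ.1 k‖ := norm_inner_le_norm _ _
      _ = 1 * ‖k‖ ^ 2 := by rw [hψ.norm_toeplitz]; ring
  exact le_of_mul_le_mul_right h1 (by positivity)

theorem IsInner.norm_lt_one {ψ : ℂ → ℂ} (hψ : IsInner ψ) (hc : ¬ IsConstantOnDisc ψ) {z : ℂ}
    (hz : z ∈ ball (0 : ℂ) 1) : ‖ψ z‖ < 1 := by
  refine (hψ.norm_le_one hz).lt_of_ne fun h => hc ⟨ψ z, ?_⟩
  exact Complex.eqOn_of_isPreconnected_of_isMaxOn_norm (convex_ball 0 1).isPreconnected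
    isOpen_ball hψ.1.1 hz fun w hw => by
      simpa [h] using hψ.norm_le_one hw

end Hardy

/-! ### Operators intertwined with an isometry -/

namespace ContinuousLinearMap

variable {H : Type*} [NormedAddCommGroup H] [InnerProductSpace ℂ H]

/-- For a unitary `V` this is `|v - conj l| = |1 - l v|` on the unit circle. -/
theorem norm_apply_sub_conj_smul_of_isometry {V : H →L[ℂ] H} (hV : ∀ x, ‖V x‖ = ‖x‖) (l : ℂ)
    (h : H) : ‖V h - conj l • h‖ = ‖h - l • V h‖ := by
  refine (pow_left_inj₀ (norm_nonneg _) (norm_nonneg _) two_ne_zero).1 ?_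
  rw [@norm_sub_sq ℂ, @norm_sub_sq ℂ, norm_smul, norm_smul, inner_smul_right, inner_smul_right,
    hV, ← inner_conj_symm h (V h), RCLike.norm_conj]
  have : l * conj ⟪V h, h⟫_ℂ = conj (conj l * ⟪V h, h⟫_ℂ) := by simp
  rw [this, RCLike.conj_re]

theorem norm_pow_sub_conj_smul_of_isometry {V : H →L[ℂ] H} (hV : ∀ x, ‖V x‖ = ‖x‖) (l : ℂ)
    (n : ℕ) (h : H) : ‖((V - conj l • 1) ^ n) h‖ = ‖((1 - l • V) ^ n) h‖ := by
  have hcomm : Commute (V - conj l • 1) (1 - l • V) := by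
    refine Commute.sub_left (Commute.sub_right (Commute.one_right _)
      ((Commute.refl V).smul_right l)) ?_
    exact (Commute.one_left _).smul_left _
  induction n generalizing h with
  | zero => simp
  | succ n ih =>
    calc ‖((V - conj l • 1) ^ (n + 1)) h‖
        = ‖V (((V - conj l • 1) ^ n) h) - conj l • ((V - conj l • 1) ^ n) h‖ := by
          rw [pow_succ']; rfl
      _ = ‖((1 - l • V) * (V - conj l • 1) ^ n) h‖ :=
          norm_apply_sub_conj_smul_of_isometry hV l _
      _ = ‖((V - conj l • 1) ^ n) ((1 - l • V) h)‖ := by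
          rw [← (hcomm.pow_left n).eq]; rfl
      _ = ‖((1 - l • V) ^ (n + 1)) h‖ := by
          rw [ih, pow_succ]; rfl

variable [CompleteSpace H]

/-- If `X` intertwines `B` with an isometry `V`, then either a point `l` of the disc is an eigenvalue
of `B†`, or `V - conj l` can be divided out of `X`, and the quotient still intertwines. -/
theorem exists_eq_sub_conj_smul_comp {V B X : H →L[ℂ] H} (hV : ∀ x, ‖V x‖ = ‖x‖) {l : ℂ}
    (hl : ‖l‖ < 1) (hX : X ∘L B = V ∘L X) (hB : ∀ v, adjoint B v = l • v → v = 0) :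
    ∃ Y : H →L[ℂ] H, X = (V - conj l • 1) ∘L Y ∧ Y ∘L B = V ∘L Y := by
  set A : H →L[ℂ] H := V - conj l • 1 with hA
  have hAx : ∀ x, A x = V x - conj l • x := fun x => rfl
  have hlow : ∀ x, (1 - ‖l‖) * ‖x‖ ≤ ‖A x‖ := by
    intro x
    calc (1 - ‖l‖) * ‖x‖ = ‖V x‖ - ‖conj l • x‖ := by
          rw [hV, norm_smul, RCLike.norm_conj]; ring
      _ ≤ ‖A x‖ := norm_sub_norm_le _ _
  obtain ⟨K, hK⟩ : ∃ K, AntilipschitzWith K A := by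
    refine ⟨⟨(1 - ‖l‖)⁻¹, by simpa using hl.le⟩, A.antilipschitz_of_bound fun x => ?_⟩
    have h0 : 0 < 1 - ‖l‖ := by linarith
    change ‖x‖ ≤ (1 - ‖l‖)⁻¹ * ‖A x‖
    rw [inv_mul_eq_div, le_div_iff₀ h0, mul_comm]
    exact hlow x
  have hcl : IsClosed (Set.range A) := hK.isClosed_range A.uniformContinuous
  have hmem : ∀ x, X x ∈ A.range := by
    intro x
    have hperp : X x ∈ (A.rangeᗮ)ᗮ := by
      -- An eigenvector `u` of `V†` for `l` is sent by `X†` to an eigenvector of `B†` or to zero, hence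
      -- to zero; so `X x` is orthogonal to `ker A†`.
      rw [A.orthogonal_range, Submodule.mem_orthogonal]
      intro u hu
      have hu' : adjoint V u = l • u := by
        refine ext_inner_right ℂ fun y => ?_
        have h1 : ⟪adjoint A u, y⟫_ℂ = 0 := by
          rw [show adjoint A u = 0 from hu, inner_zero_left]
        rw [adjoint_inner_left, hAx, inner_sub_right, inner_smul_right, sub_eq_zero] at h1
        rw [adjoint_inner_left, h1, inner_smul_left]
      have h2 : adjoint X u = 0 := by
        refine hB _ ?_
        have := congrArg (fun S => adjoint S u) hX
        simp only [adjoint_comp, comp_apply] at this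
        rw [this, hu', map_smul]
      rw [← adjoint_inner_left, h2, inner_zero_left]
    have : CompleteSpace A.range := IsClosed.completeSpace_coe (s := Set.range A) (hs := hcl)
    rwa [Submodule.orthogonal_orthogonal] at hperp
  let e := A.equivRange hK.injective hcl
  let Y : H →L[ℂ] H := (e.symm : A.range →L[ℂ] H) ∘L X.codRestrict A.range hmem
  have hY : ∀ x, A (Y x) = X x := fun x =>
    congrArg Subtype.val (e.apply_symm_apply (X.codRestrict A.range hmem x))
  refine ⟨Y, ContinuousLinearMap.ext fun x => (hY x).symm,
    ContinuousLinearMap.ext fun x => hK.injective ?_⟩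
  change A (Y (B x)) = A (V (Y x))
  -- `A` commutes with `V` and is injective, so the intertwining relation passes from `X = A Y` to `Y`.
  have h3 : A (V (Y x)) = V (A (Y x)) := by simp [hAx]
  rw [h3, hY, hY]
  exact congrArg (fun S : H →L[ℂ] H => S x) hX

theorem exists_eq_pow_sub_conj_smul_comp {V B X : H →L[ℂ] H} (hV : ∀ x, ‖V x‖ = ‖x‖) {l : ℂ}
    (hl : ‖l‖ < 1) (hX : X ∘L B = V ∘L X) (hB : ∀ v, adjoint B v = l • v → v = 0) (n : ℕ) :
    ∃ Y : H →L[ℂ] H, X = ((V - conj l • 1) ^ n) ∘L Y ∧ Y ∘L B = V ∘L Y := by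
  induction n with
  | zero => exact ⟨X, rfl, hX⟩
  | succ n ih =>
    obtain ⟨Y, hXY, hY⟩ := ih
    obtain ⟨Z, hYZ, hZ⟩ := exists_eq_sub_conj_smul_comp hV hl hY hB
    refine ⟨Z, ?_, hZ⟩
    rw [hXY, hYZ, pow_succ]
    rfl

end ContinuousLinearMap

/-! ### The point spectrum of an operator intertwined with an inner function -/

theorem Complex.norm_sub_conj_lt_norm_one_sub_mul {a l : ℂ} (ha : ‖a‖ < 1)
    (hl : ‖l‖ < 1) : ‖a - conj l‖ < ‖1 - l * a‖ := by
  refine lt_of_pow_lt_pow_left₀ 2 (norm_nonneg _) ?_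
  have h1 : ‖1 - l * a‖ ^ 2 - ‖a - conj l‖ ^ 2 = (1 - ‖a‖ ^ 2) * (1 - ‖l‖ ^ 2) := by
    simp only [← normSq_eq_norm_sq, normSq_apply, sub_re, sub_im, mul_re, mul_im, one_re, one_im,
      conj_re, conj_im]
    ring
  have h2 : 0 < (1 - ‖a‖ ^ 2) * (1 - ‖l‖ ^ 2) :=
    mul_pos (sub_pos.2 (pow_lt_one₀ (norm_nonneg _) ha two_ne_zero))
      (sub_pos.2 (pow_lt_one₀ (norm_nonneg _) hl two_ne_zero))
  linarith

namespace Hardy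

theorem H2.eval_zero (z : ℂ) : H2.eval 0 z = 0 := by simp [H2.eval]

theorem H2.eval_sub (f g : H2) {z : ℂ} (hz : z ∈ ball (0 : ℂ) 1) :
    H2.eval (f - g) z = H2.eval f z - H2.eval g z := by
  rw [sub_eq_add_neg, ← neg_one_smul ℂ g, H2.eval_add _ _ hz, H2.eval_smul]
  ring

theorem H2.eval_pow_apply {A : H2 →L[ℂ] H2} {a z : ℂ}
    (hA : ∀ f, H2.eval (A f) z = a * H2.eval f z) (n : ℕ) (f : H2) :
    H2.eval ((A ^ n) f) z = a ^ n * H2.eval f z := by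
  induction n generalizing f with
  | zero => simp
  | succ n ih =>
    rw [pow_succ, mul_apply_eq_comp, ih, hA, pow_succ, mul_assoc]

/-- The intersection of the ranges of the powers of `T_ψ - conj l` is trivial for `ψ` inner and
nonconstant. -/
theorem IsInner.eq_zero_of_forall_exists_pow {ψ : ℂ → ℂ} (hψ : IsInner ψ)
    (hb : IsBoundedAnalytic ψ) (hc : ¬ IsConstantOnDisc ψ) {l : ℂ} (hl : ‖l‖ < 1) {f : H2}
    (hf : ∀ n : ℕ, ∃ h : H2, ((toeplitz ψ hb - conj l • 1) ^ n) h = f) : f = 0 := by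
  refine H2.ext_eval fun z hz => ?_
  rw [H2.eval_zero]
  obtain ⟨C, hC0, hC⟩ := H2.exists_norm_eval_le hz
  have hA : ∀ h, H2.eval ((toeplitz ψ hb - conj l • 1) h) z
      = (ψ z - conj l) * H2.eval h z := by
    intro h
    change H2.eval (toeplitz ψ hb h - conj l • h) z = _
    rw [H2.eval_sub _ _ hz, toeplitz_eval hb h hz, H2.eval_smul]
    ring
  have hB : ∀ h, H2.eval ((1 - l • toeplitz ψ hb) h) z = (1 - l * ψ z) * H2.eval h z := by
    intro h
    change H2.eval (h - l • toeplitz ψ hb h) z = _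
    rw [H2.eval_sub _ _ hz, H2.eval_smul, toeplitz_eval hb h hz]
    ring
  have hlt := Complex.norm_sub_conj_lt_norm_one_sub_mul (hψ.norm_lt_one hc hz) hl
  have hpos : 0 < ‖1 - l * ψ z‖ := (norm_nonneg _).trans_lt hlt
  set q := ‖ψ z - conj l‖ / ‖1 - l * ψ z‖ with hq
  have hq0 : 0 ≤ q := by positivity
  have hq1 : q < 1 := (div_lt_one hpos).2 hlt
  -- With `f = (T_ψ - conj l)ⁿ h`, the function `g = (1 - l T_ψ)ⁿ h` has the norm of `f`, and `f = bⁿ g`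
  -- for `b = (ψ - conj l) / (1 - l ψ)`, where `|b z| = q`.
  have key : ∀ n : ℕ, ‖H2.eval f z‖ ≤ q ^ n * (C * ‖f‖) := by
    intro n
    obtain ⟨h, hh⟩ := hf n
    have h1 := hC (((1 - l • toeplitz ψ hb) ^ n) h)
    rw [← ContinuousLinearMap.norm_pow_sub_conj_smul_of_isometry (hψ.norm_toeplitz hb), hh,
      H2.eval_pow_apply hB, norm_mul, norm_pow] at h1
    have h2 : ‖H2.eval f z‖ = ‖ψ z - conj l‖ ^ n * ‖H2.eval h z‖ := by
      rw [← hh, H2.eval_pow_apply hA, norm_mul, norm_pow]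
    calc ‖H2.eval f z‖ = q ^ n * (‖1 - l * ψ z‖ ^ n * ‖H2.eval h z‖) := by
          rw [h2, hq, div_pow, ← mul_assoc, div_mul_cancel₀ _ (by positivity)]
      _ ≤ q ^ n * (C * ‖f‖) := by gcongr
  have ht : Tendsto (fun n : ℕ => q ^ n * (C * ‖f‖)) atTop (𝓝 0) := by
    simpa using (tendsto_pow_atTop_nhds_zero_of_lt_one hq0 hq1).mul_const (C * ‖f‖)
  exact norm_le_zero_iff.1 (ge_of_tendsto' ht key)

theorem mem_pointSpectrum_of_ne_zero {A : H2 →L[ℂ] H2} {l : ℂ} {v : H2} (hv : A v = l • v)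
    (h0 : v ≠ 0) : l ∈ pointSpectrum A :=
  Module.End.hasEigenvalue_of_hasEigenvector (x := v)
    ⟨Module.End.mem_eigenspace_iff.2 hv, h0⟩

/-- Any bounded operator intertwined with a nonconstant inner function has every point of the disc
in the point spectrum of its adjoint; that it is a Toeplitz operator plays no role. -/
theorem Intertwined.ball_subset_pointSpectrum_adjoint {ψ : ℂ → ℂ} (hψ : IsInner ψ)
    (hb : IsBoundedAnalytic ψ) (hc : ¬ IsConstantOnDisc ψ) {B : H2 →L[ℂ] H2}
    (h : Intertwined B (toeplitz ψ hb)) :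
    ball (0 : ℂ) 1 ⊆ pointSpectrum (ContinuousLinearMap.adjoint B) := by
  obtain ⟨X, hX0, hX⟩ := h
  intro l hl
  have hl' : ‖l‖ < 1 := by simpa using hl
  by_contra hspec
  have hB : ∀ v, ContinuousLinearMap.adjoint B v = l • v → v = 0 := fun v hv =>
    by_contra fun h0 => hspec (mem_pointSpectrum_of_ne_zero hv h0)
  refine hX0 (ContinuousLinearMap.ext fun f => ?_)
  refine hψ.eq_zero_of_forall_exists_pow hb hc hl' fun n => ?_
  obtain ⟨Y, hY, -⟩ := ContinuousLinearMap.exists_eq_pow_sub_conj_smul_comp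
    (hψ.norm_toeplitz hb) hl' hX hB n
  exact ⟨Y f, by rw [hY]; rfl⟩

theorem Intertwined.conj_mem_pointSpectrum_adjoint {B V : H2 →L[ℂ] H2} {c : ℂ}
    (hV : V = c • 1) (h : Intertwined B V) :
    conj c ∈ pointSpectrum (ContinuousLinearMap.adjoint B) := by
  obtain ⟨X, hX0, hX⟩ := h
  have hX' : ContinuousLinearMap.adjoint X ≠ 0 := by simpa using hX0
  obtain ⟨u, hu⟩ := DFunLike.ne_iff.1 hX'
  refine mem_pointSpectrum_of_ne_zero (v := ContinuousLinearMap.adjoint X u) ?_ hu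
  refine ext_inner_right ℂ fun y => ?_
  rw [ContinuousLinearMap.adjoint_inner_left, ContinuousLinearMap.adjoint_inner_left,
    ← ContinuousLinearMap.comp_apply, hX, hV, inner_smul_left,
    ContinuousLinearMap.adjoint_inner_left]
  simp [inner_smul_right]

end Hardy

/-! ### Herglotz integrals and approximate inverses of outer functions -/

theorem CircleIntegrable.complex_ofReal {u : ℂ → ℝ} {c : ℂ} {R : ℝ}
    (hu : CircleIntegrable u c R) : CircleIntegrable (fun ζ => (u ζ : ℂ)) c R := by
  simp only [CircleIntegrable, intervalIntegrable_iff] at hu ⊢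
  exact Complex.ofRealCLM.integrable_comp hu

namespace Hardy

open Real (circleAverage)

/-- The Herglotz integral of a real function `u` on the unit circle: on the disc, the analytic
function whose real part is the Poisson integral of `u`. -/
noncomputable def herglotzIntegral (u : ℂ → ℝ) (z : ℂ) : ℂ :=
  circleAverage (fun ζ => herglotzRieszKernel 0 z ζ • (u ζ : ℂ)) 0 1

theorem circleIntegrable_herglotz {u : ℂ → ℝ} (hu : CircleIntegrable u 0 1) {z : ℂ}
    (hz : z ∈ ball (0 : ℂ) 1) :
    CircleIntegrable (fun ζ => herglotzRieszKernel 0 z ζ • (u ζ : ℂ)) 0 1 :=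
  hu.complex_ofReal.continuousOn_smul (continuousOn_herglotzRieszKernel_sphere hz)

theorem differentiableOn_herglotzIntegral {u : ℂ → ℝ} (hu : CircleIntegrable u 0 1) :
    DifferentiableOn ℂ (herglotzIntegral u) (ball 0 1) :=
  differentiableOn_circleAverage_herglotzRieszKernel_smul hu.complex_ofReal

theorem herglotzIntegral_add {u v : ℂ → ℝ} (hu : CircleIntegrable u 0 1)
    (hv : CircleIntegrable v 0 1) {z : ℂ} (hz : z ∈ ball (0 : ℂ) 1) :
    herglotzIntegral (u + v) z = herglotzIntegral u z + herglotzIntegral v z := by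
  unfold herglotzIntegral
  rw [← Real.circleAverage_fun_add (circleIntegrable_herglotz hu hz)
    (circleIntegrable_herglotz hv hz)]
  congr 1
  ext ζ
  simp [mul_add]

theorem re_herglotzIntegral_le {u : ℂ → ℝ} (hu : CircleIntegrable u 0 1) {a : ℝ}
    (ha : ∀ ζ ∈ sphere (0 : ℂ) 1, u ζ ≤ a) {z : ℂ} (hz : z ∈ ball (0 : ℂ) 1) :
    (herglotzIntegral u z).re ≤ a := by
  have hker : ContinuousOn (re ∘ herglotzRieszKernel 0 z) (sphere 0 |1|) :=
    continuous_re.comp_continuousOn (continuousOn_herglotzRieszKernel_sphere hz)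
  -- The Poisson kernel has mean one: Poisson's formula for a constant function.
  have hmean : circleAverage ((re ∘ herglotzRieszKernel 0 z) • fun _ => a) 0 1 = a := by
    have h1 := (diffContOnCl_const (𝕜 := ℂ) (s := ball (0 : ℂ) 1)
      (c := (a : ℂ))).circleAverage_re_herglotzRieszKernel_smul hz
    refine Complex.ofReal_injective (Eq.trans ?_ h1)
    refine (Complex.ofRealCLM.circleAverage_comp_comm
      ((circleIntegrable_const a 0 1).continuousOn_smul hker)).symm.trans ?_
    congr 1
    ext ζ
    simp
  rw [herglotzIntegral, re_circleAverage_herglotzRieszKernel_smul hu hz]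
  refine le_trans ?_ hmean.le
  refine Real.circleAverage_mono (hu.continuousOn_smul hker)
    ((circleIntegrable_const a 0 1).continuousOn_smul hker) fun ζ hζ => ?_
  rw [abs_one] at hζ
  have hpos : 0 ≤ (herglotzRieszKernel 0 z ζ).re := by
    have hz' : ‖z‖ < 1 := by simpa using hz
    refine le_trans ?_ (le_re_herglotzRieszKernel hζ hz)
    rw [sub_zero]
    exact div_nonneg (by linarith) (by positivity)
  exact mul_le_mul_of_nonneg_left (ha ζ hζ) hpos

theorem tendsto_herglotzIntegral_zero {u : ℕ → ℂ → ℝ} {v : ℂ → ℝ}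
    (hu : ∀ n, CircleIntegrable (u n) 0 1) (hv : CircleIntegrable v 0 1)
    (huv : ∀ n ζ, |u n ζ| ≤ |v ζ|) (hlim : ∀ ζ, Tendsto (fun n => u n ζ) atTop (𝓝 0))
    {z : ℂ} (hz : z ∈ ball (0 : ℂ) 1) :
    Tendsto (fun n => herglotzIntegral (u n) z) atTop (𝓝 0) := by
  have key : Tendsto (fun n => ∫ θ in (0 : ℝ)..2 * Real.pi,
      herglotzRieszKernel 0 z (circleMap 0 1 θ) • (u n (circleMap 0 1 θ) : ℂ)) atTop
      (𝓝 (∫ θ in (0 : ℝ)..2 * Real.pi, (0 : ℂ))) := by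
    refine intervalIntegral.tendsto_integral_filter_of_dominated_convergence
      (fun θ => ‖herglotzRieszKernel 0 z (circleMap 0 1 θ) • (v (circleMap 0 1 θ) : ℂ)‖)
      (Eventually.of_forall fun n => ?_) (Eventually.of_forall fun n => ?_)
      (IntervalIntegrable.norm (circleIntegrable_herglotz hv hz)) ?_
    · exact (intervalIntegrable_iff.1 (circleIntegrable_herglotz (hu n) hz)).aestronglyMeasurable
    · refine Eventually.of_forall fun θ _ => ?_
      rw [norm_smul, norm_smul, norm_real, norm_real]
      exact mul_le_mul_of_nonneg_left (huv n _) (norm_nonneg _)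
    · refine Eventually.of_forall fun θ _ => ?_
      have h1 : Tendsto (fun n => (u n (circleMap 0 1 θ) : ℂ)) atTop (𝓝 ((0 : ℝ) : ℂ)) :=
        (continuous_ofReal.tendsto 0).comp (hlim _)
      simpa using h1.const_smul (herglotzRieszKernel 0 z (circleMap 0 1 θ))
  unfold herglotzIntegral
  simp only [Real.circleAverage_def]
  simpa using key.const_smul (2 * Real.pi)⁻¹

/-- An outer function of modulus `w` is inverted, in the limit, by the outer functions of modulus
`exp (min (-log w, n))`. -/
theorem IsOuter.exists_approximate_inverse {φ : ℂ → ℂ} (hφ : IsOuter φ) :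
    ∃ h : ℕ → ℂ → ℂ, (∀ n, IsBoundedAnalytic (h n)) ∧
      (∀ n, ∀ z ∈ ball (0 : ℂ) 1, ‖φ z * h n z‖ ≤ 1) ∧
      ∀ z ∈ ball (0 : ℂ) 1, Tendsto (fun n => φ z * h n z) atTop (𝓝 1) := by
  obtain ⟨c, w, hc, -, hint, hφ⟩ := hφ
  set L : ℂ → ℝ := fun ζ => Real.log (w ζ) with hL
  have hcc : c * conj c = 1 := by rw [mul_conj, normSq_eq_norm_sq, hc]; simp
  set v : ℕ → ℂ → ℝ := fun n ζ => min (-L ζ) n with hv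
  have hvint : ∀ n, CircleIntegrable (v n) 0 1 := by
    intro n
    have h1 : IntervalIntegrable (fun θ => L (circleMap 0 1 θ)) MeasureTheory.volume 0
      (2 * Real.pi) := hint
    have h2 : IntervalIntegrable (fun _ : ℝ => (n : ℝ)) MeasureTheory.volume 0 (2 * Real.pi) :=
      intervalIntegrable_const
    -- The infimum of two integrable functions is integrable.
    have h3 := (intervalIntegrable_iff.1 h1).neg.inf (intervalIntegrable_iff.1 h2)
    exact intervalIntegrable_iff.2 h3
  have hsum : ∀ n ζ, (L + v n) ζ = min 0 (L ζ + n) := by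
    intro n ζ
    simp only [Pi.add_apply, hv]
    rw [← min_add_add_left, add_neg_cancel]
  have hprod : ∀ n, ∀ z ∈ ball (0 : ℂ) 1,
      φ z * (conj c * exp (herglotzIntegral (v n) z)) = exp (herglotzIntegral (L + v n) z) := by
    intro n z hz
    have : φ z = c * exp (herglotzIntegral L z) := by
      rw [hφ z hz, herglotzIntegral]
      simp [herglotzRieszKernel_def, hL]
    rw [this, herglotzIntegral_add hint (hvint n) hz, exp_add]
    linear_combination (exp (herglotzIntegral L z) * exp (herglotzIntegral (v n) z)) * hcc
  refine ⟨fun n z => conj c * exp (herglotzIntegral (v n) z), fun n => ⟨?_, Real.exp n, ?_⟩,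
    fun n z hz => ?_, fun z hz => ?_⟩
  · exact (differentiableOn_herglotzIntegral (hvint n)).cexp.const_mul _
  · intro z hz
    rw [norm_mul, RCLike.norm_conj, hc, one_mul, norm_exp]
    exact Real.exp_le_exp.2 (re_herglotzIntegral_le (hvint n) (fun ζ _ => min_le_right _ _) hz)
  · rw [hprod n z hz, norm_exp, ← Real.exp_zero]
    refine Real.exp_le_exp.2 (re_herglotzIntegral_le (CircleIntegrable.add hint (hvint n))
      (fun ζ _ => ?_) hz)
    rw [hsum]
    exact min_le_left _ _
  · simp only [hprod _ z hz]
    rw [← exp_zero]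
    refine (continuous_exp.tendsto 0).comp (tendsto_herglotzIntegral_zero
      (fun n => CircleIntegrable.add hint (hvint n)) hint (fun n ζ => ?_) (fun ζ => ?_) hz)
    · rw [hsum, abs_of_nonpos (min_le_left _ _), neg_le]
      refine le_min (neg_nonpos.2 (abs_nonneg _)) ?_
      have := neg_abs_le (L ζ)
      have := n.cast_nonneg (α := ℝ)
      linarith
    · refine tendsto_const_nhds.congr' ?_
      filter_upwards [eventually_ge_atTop ⌈-L ζ⌉₊] with n hn
      have := Nat.ceil_le.1 hn
      rw [hsum, min_eq_left (by linarith)]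

/-! ### Injectivity of the adjoint of an outer Toeplitz operator -/

/-- A vector orthogonal to all kernels is a function that vanishes on the disc. -/
theorem H2.span_reproducing_kernels_dense :
    (Submodule.span ℂ {k : H2 | ∃ z ∈ ball (0 : ℂ) 1, ∀ f : H2,
      ⟪k, f⟫_ℂ = H2.eval f z}).topologicalClosure = ⊤ := by
  rw [Submodule.topologicalClosure_eq_top_iff, Submodule.eq_bot_iff]
  intro f hf
  refine H2.ext_eval fun z hz => ?_
  obtain ⟨k, hk⟩ := H2.exists_reproducing_kernel hz
  rw [H2.eval_zero, ← hk]
  exact (Submodule.mem_orthogonal _ _).1 hf k (Submodule.subset_span ⟨z, hz, hk⟩)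

theorem IsBoundedAnalytic.mul {φ ψ : ℂ → ℂ} (hφ : IsBoundedAnalytic φ)
    (hψ : IsBoundedAnalytic ψ) : IsBoundedAnalytic fun z => φ z * ψ z := by
  obtain ⟨hd, M, hM⟩ := hφ
  obtain ⟨hd', M', hM'⟩ := hψ
  refine ⟨hd.mul hd', M * M', fun z hz => ?_⟩
  rw [norm_mul]
  exact mul_le_mul (hM z hz) (hM' z hz) (norm_nonneg _) ((norm_nonneg _).trans (hM z hz))

theorem toeplitz_mul {φ ψ : ℂ → ℂ} (hφ : IsBoundedAnalytic φ) (hψ : IsBoundedAnalytic ψ) :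
    toeplitz (fun z => φ z * ψ z) (hφ.mul hψ) = toeplitz φ hφ ∘L toeplitz ψ hψ := by
  refine (toeplitz_unique _ fun f z hz => ?_).symm
  rw [ContinuousLinearMap.comp_apply, toeplitz_eval hφ _ hz, toeplitz_eval hψ _ hz, mul_assoc]

theorem norm_toeplitz_apply_le {φ : ℂ → ℂ} (hφ : IsBoundedAnalytic φ) {M : ℝ}
    (hM : ∀ z ∈ ball (0 : ℂ) 1, ‖φ z‖ ≤ M) (f : H2) : ‖toeplitz φ hφ f‖ ≤ M * ‖f‖ := by
  obtain ⟨g, hg, hn⟩ := exists_mul hφ.1 hM f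
  rwa [H2.ext_eval (f := toeplitz φ hφ f) (g := g) fun z hz => by
    rw [toeplitz_eval hφ f hz, hg z hz]]

theorem adjoint_toeplitz_apply_kernel {φ : ℂ → ℂ} (hφ : IsBoundedAnalytic φ) {z : ℂ}
    (hz : z ∈ ball (0 : ℂ) 1) {k : H2} (hk : ∀ f : H2, ⟪k, f⟫_ℂ = H2.eval f z) :
    ContinuousLinearMap.adjoint (toeplitz φ hφ) k = conj (φ z) • k := by
  refine ext_inner_right ℂ fun f => ?_
  rw [ContinuousLinearMap.adjoint_inner_left, hk, toeplitz_eval hφ f hz, inner_smul_left, hk]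
  simp

/-- Equivalently, an outer function generates a dense invariant subspace of `H²`. -/
theorem IsOuter.eq_zero_of_adjoint_toeplitz_eq_zero {φ : ℂ → ℂ} (ho : IsOuter φ)
    (hφ : IsBoundedAnalytic φ) {f : H2}
    (hf : ContinuousLinearMap.adjoint (toeplitz φ hφ) f = 0) : f = 0 := by
  obtain ⟨h, hh, hle, hlim⟩ := ho.exists_approximate_inverse
  set T : ℕ → H2 →L[ℂ] H2 := fun n =>
    ContinuousLinearMap.adjoint (toeplitz _ (hφ.mul (hh n))) with hT
  have hTf : ∀ n, T n f = 0 := by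
    intro n
    change ContinuousLinearMap.adjoint (toeplitz _ (hφ.mul (hh n))) f = 0
    rw [toeplitz_mul hφ (hh n), ContinuousLinearMap.adjoint_comp, ContinuousLinearMap.comp_apply,
      hf, map_zero]
  have hTle : ∀ n g, ‖T n g‖ ≤ ‖g‖ := by
    intro n g
    have h1 : ‖T n‖ ≤ 1 := by
      rw [hT, LinearIsometryEquiv.norm_map]
      exact ContinuousLinearMap.opNorm_le_bound _ zero_le_one
        (norm_toeplitz_apply_le _ (hle n))
    simpa using (T n).le_of_opNorm_le h1 g
  have hTlim : ∀ k ∈ Submodule.span ℂ {k : H2 | ∃ z ∈ ball (0 : ℂ) 1, ∀ f : H2,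
      ⟪k, f⟫_ℂ = H2.eval f z}, Tendsto (fun n => T n k) atTop (𝓝 k) := by
    intro k hk
    induction hk using Submodule.span_induction with
    | mem k hk =>
      obtain ⟨z, hz, hk⟩ := hk
      have h1 : Tendsto (fun n => conj (φ z * h n z)) atTop (𝓝 (conj 1)) :=
        (continuous_conj.tendsto 1).comp (hlim z hz)
      simpa [hT, adjoint_toeplitz_apply_kernel _ hz hk] using h1.smul_const k
    | zero => simp
    | add x y _ _ hx hy => simpa using hx.add hy
    | smul a x _ hx => simpa using hx.const_smul a
  -- If `T n f = 0` and `k` is near `f`, then `T n k` is uniformly small, but it converges to `k`.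
  refine norm_le_zero_iff.1 (le_of_forall_pos_le_add fun ε hε => ?_)
  have hfcl : f ∈ (Submodule.span ℂ {k : H2 | ∃ z ∈ ball (0 : ℂ) 1, ∀ f : H2,
      ⟪k, f⟫_ℂ = H2.eval f z}).topologicalClosure := by
    rw [H2.span_reproducing_kernels_dense]; trivial
  obtain ⟨k, hk, hfk⟩ := Metric.mem_closure_iff.1 hfcl (ε / 2) (half_pos hε)
  have h1 : ‖k‖ ≤ ‖f - k‖ := by
    refine le_of_tendsto (hTlim k hk).norm (Eventually.of_forall fun n => ?_)
    calc ‖T n k‖ = ‖T n (f - k)‖ := by rw [map_sub, hTf, zero_sub, norm_neg]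
      _ ≤ ‖f - k‖ := hTle n _
  have h2 := norm_add_le (f - k) k
  rw [sub_add_cancel] at h2
  rw [dist_eq_norm] at hfk
  linarith

end Hardy

/-! ### Intertwining with inner functions -/

theorem corollary6p3 (φ ψ : ℂ → ℂ)
    (hφ : Hardy.IsBoundedAnalytic φ) (hψ : Hardy.IsBoundedAnalytic ψ) :
    -- nonconstant inner `ψ` and `T_φ ∝ T_ψ`: the point spectrum of `T_φ^*` contains the disc
    (Hardy.IsInner ψ → ¬ Hardy.IsConstantOnDisc ψ →
      Hardy.Intertwined (Hardy.toeplitz φ hφ) (Hardy.toeplitz ψ hψ) →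
      ball (0 : ℂ) 1 ⊆
        Hardy.pointSpectrum (ContinuousLinearMap.adjoint (Hardy.toeplitz φ hφ))) ∧
    -- inner `ψ` and `T_φ ∝ T_ψ`: the conjugates of the values of `ψ` are in the point spectrum
    (Hardy.IsInner ψ →
      Hardy.Intertwined (Hardy.toeplitz φ hφ) (Hardy.toeplitz ψ hψ) →
      (fun z => conj (ψ z)) '' ball (0 : ℂ) 1 ⊆
        Hardy.pointSpectrum (ContinuousLinearMap.adjoint (Hardy.toeplitz φ hφ))) ∧
    -- outer `φ` and nonconstant inner `ψ`: `T_φ ∝ T_ψ` fails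
    (Hardy.IsOuter φ → Hardy.IsInner ψ → ¬ Hardy.IsConstantOnDisc ψ →
      ¬ Hardy.Intertwined (Hardy.toeplitz φ hφ) (Hardy.toeplitz ψ hψ)) := by
  refine ⟨fun hi hc h => h.ball_subset_pointSpectrum_adjoint hi hψ hc, ?_, ?_⟩
  · rintro hi h _ ⟨z, hz, rfl⟩
    by_cases hc : Hardy.IsConstantOnDisc ψ
    · obtain ⟨c, hc⟩ := hc
      refine h.conj_mem_pointSpectrum_adjoint (c := ψ z) (Eq.symm ?_)
      refine Hardy.toeplitz_unique hψ fun f y hy => ?_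
      rw [hc z hz, hc y hy]
      exact Hardy.H2.eval_smul c f y
    · exact h.ball_subset_pointSpectrum_adjoint hi hψ hc (by simpa using hi.norm_lt_one hc hz)
  · intro ho hi hc h
    have h0 := h.ball_subset_pointSpectrum_adjoint hi hψ hc (mem_ball_self one_pos)
    obtain ⟨f, hf⟩ := Module.End.HasEigenvalue.exists_hasEigenvector h0
    exact hf.2 (ho.eq_zero_of_adjoint_toeplitz_eq_zero hφ (by simpa using hf.apply_eq_smul))
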